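/- Let $\mu,\theta\in\mathbb{R}$ with $\mu>0$ and $|\mu\cos\pi\theta|>1$, and put $q=e^{2\pi i\theta}$, $z=\dfrac{e^{i\pi\theta}}{2i\cos\pi\theta}$. Let $A^0_{\mu,\theta}$ be the quotient of the unital free $*$-algebra $\mathbb{C}\langle W,W^*,\Lambda,\Lambda^*\rangle$ by the two-sided ideal generated by the relations $$W\Lambda=q\Lambda W,\quad W^*\Lambda=\bar q\Lambda W^*,\quad W^*\Lambda^*=q\Lambda^*W^*,\quad W\Lambda^*=\bar q\Lambda^*W,\quad \Lambda^*\Lambda=\Lambda\Lambda^*=1,$$ $$WW^*=z\Lambda+\bar z\Lambda^*+\mu 1,\qquad W^*W=-\bar z\Lambda-z\Lambda^*+\mu 1,$$ and let $C_\theta$ be the noncommutative torus, i.e. the universal unital $C^*$-algebra generated by $U,V$ with $VU=e^{2\pi i\theta}UV$, $U^*U=UU^*=1$, $V^*V=VV^*=1$. Then $\mu 1+zU+\bar zU^*$ is positive and invertible in $C_\theta$, and there is a unique unital $*$-homomorphism $\phi:A^0_{\mu,\theta}\to C_\theta$ with $$\phi(W)=\sqrt{\mu 1+zU+\bar zU^*}\;V,\qquad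 \phi(\Lambda)=U.$$ It is injective, so that $\|a\|=\|\phi(a)\|$ is a $C^*$-norm on $A^0_{\mu,\theta}$; let $A_{\mu,\theta}$ be the completion of $A^0_{\mu,\theta}$ in this norm. The continuous extension $\phi:A_{\mu,\theta}\to C_\theta$ is an (isometric) isomorphism of $C^*$-algebras. The element $\mu 1+z\Lambda+\bar z\Lambda^*$ is positive and invertible in $A_{\mu,\theta}$, and the inverse of $\phi$ is determined by $$\phi^{-1}(U)=\Lambda,\qquad \phi^{-1}(V)=(\mu 1+z\Lambda+\bar z\Lambda^*)^{-1/2}\,W.$$ -/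

import Mathlib

noncomputable section

namespace NCTorus

/-! ### Unital free `*`-algebras over `ℂ` -/

/-- The unital free `*`-algebra over `ℂ` on the generators `x` and `x^*`, `x : X`: the free algebra on
two copies of `X`. The letter `Sum.inl x` is `x` and the letter `Sum.inr x` is `x^*`. -/
def FreeStarAlg (X : Type) : Type := FreeAlgebra ℂ (X ⊕ X)

namespace FreeStarAlg

variable {X : Type}

instance : Ring (FreeStarAlg X) := inferInstanceAs (Ring (FreeAlgebra ℂ (X ⊕ X)))

instance : Algebra ℂ (FreeStarAlg X) := inferInstanceAs (Algebra ℂ (FreeAlgebra ℂ (X ⊕ X)))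

/-- A letter, as an element of the free algebra. -/
def letter (y : X ⊕ X) : FreeStarAlg X := FreeAlgebra.ι ℂ y

/-- The generator `x`. -/
def gen (x : X) : FreeStarAlg X := letter (Sum.inl x)

/-- The opposite ring of the free `*`-algebra, with scalars acting through complex conjugation. -/
def ConjOp (X : Type) : Type := (FreeStarAlg X)ᵐᵒᵖ

instance : Ring (ConjOp X) := inferInstanceAs (Ring (FreeStarAlg X)ᵐᵒᵖ)

instance : Algebra ℂ (ConjOp X) :=
  RingHom.toAlgebra' ((algebraMap ℂ (FreeStarAlg X)ᵐᵒᵖ).comp (starRingEnd ℂ))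
    (fun c x => Algebra.commutes (A := (FreeStarAlg X)ᵐᵒᵖ) (starRingEnd ℂ c) x)

/-- The conjugate-linear anti-homomorphism that exchanges `x` and `x^*`. -/
def starAlgHom : FreeAlgebra ℂ (X ⊕ X) →ₐ[ℂ] ConjOp X :=
  FreeAlgebra.lift ℂ (fun y : X ⊕ X => (MulOpposite.op (letter y.swap) : (FreeStarAlg X)ᵐᵒᵖ))

/-- The same map, as a ring homomorphism to the opposite ring. -/
def starHom : FreeStarAlg X →+* (FreeStarAlg X)ᵐᵒᵖ := (starAlgHom (X := X)).toRingHom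

theorem starHom_letter (y : X ⊕ X) :
    starHom (letter y) = MulOpposite.op (letter y.swap) :=
  FreeAlgebra.lift_ι_apply (A := ConjOp X) _ y

theorem starHom_algebraMap (c : ℂ) :
    starHom (algebraMap ℂ (FreeStarAlg X) c) =
      MulOpposite.op (algebraMap ℂ (FreeStarAlg X) (starRingEnd ℂ c)) :=
  (starAlgHom (X := X)).commutes c

theorem induction {motive : FreeStarAlg X → Prop}
    (scalar : ∀ c, motive (algebraMap ℂ _ c)) (letter : ∀ y, motive (letter y))
    (mul : ∀ a b, motive a → motive b → motive (a * b))
    (add : ∀ a b, motive a → motive b → motive (a + b)) (a : FreeStarAlg X) : motive a :=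
  FreeAlgebra.induction ℂ (X ⊕ X) scalar letter mul add a

theorem starHom_starHom (a : FreeStarAlg X) : (starHom (starHom a).unop).unop = a := by
  induction a using FreeStarAlg.induction with
  | scalar c => simp [starHom_algebraMap]
  | letter y => simp [starHom_letter]
  | mul a b ha hb => simp [ha, hb]
  | add a b ha hb => simp [ha, hb]

instance : StarRing (FreeStarAlg X) where
  star a := (starHom a).unop
  star_involutive := starHom_starHom
  star_mul a b := by simp
  star_add a b := by simp

theorem star_def (a : FreeStarAlg X) : star a = (starHom a).unop := rfl

instance : StarModule ℂ (FreeStarAlg X) where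
  star_smul c a := by
    simp only [star_def, Algebra.smul_def, map_mul, starHom_algebraMap, MulOpposite.unop_mul,
      MulOpposite.unop_op]
    exact (Algebra.commutes _ _).symm

end FreeStarAlg

/-! ### `*`-algebras given by generators and relations -/

/-- The relations `r`, together with their adjoints. -/
inductive StarRel {X : Type} (r : FreeStarAlg X → FreeStarAlg X → Prop) :
    FreeStarAlg X → FreeStarAlg X → Prop
  | of {a b : FreeStarAlg X} : r a b → StarRel r a b
  | adj {a b : FreeStarAlg X} : r a b → StarRel r (star a) (star b)

/-- The unital `*`-algebra with generators `X` and relations `r`: the quotient of the free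
`*`-algebra by the two-sided `*`-ideal that is generated by the `a - b` with `r a b`. -/
def StarQuot {X : Type} (r : FreeStarAlg X → FreeStarAlg X → Prop) : Type :=
  RingQuot (StarRel r)

namespace StarQuot

variable {X : Type} (r : FreeStarAlg X → FreeStarAlg X → Prop)

instance : Ring (StarQuot r) := inferInstanceAs (Ring (RingQuot (StarRel r)))

instance : Algebra ℂ (StarQuot r) := inferInstanceAs (Algebra ℂ (RingQuot (StarRel r)))

/-- The quotient map. -/
def mk : FreeStarAlg X →ₐ[ℂ] StarQuot r := RingQuot.mkAlgHom ℂ (StarRel r)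

variable {r}

theorem mk_surjective : Function.Surjective (mk r) := RingQuot.mkAlgHom_surjective ℂ (StarRel r)

theorem mk_eq {a b : FreeStarAlg X} (h : StarRel r a b) : mk r a = mk r b :=
  RingQuot.mkAlgHom_rel ℂ h

variable (r)

/-- The anti-homomorphism that the adjoint of the free `*`-algebra induces on the quotient. -/
def starHom : StarQuot r →+* (StarQuot r)ᵐᵒᵖ :=
  RingQuot.lift (r := StarRel r)
    ⟨((mk r : FreeStarAlg X →+* StarQuot r).op).comp FreeStarAlg.starHom, by
      intro a b h
      have key : mk r (star a) = mk r (star b) := by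
        cases h with
        | of h => exact mk_eq (StarRel.adj h)
        | adj h => simpa only [star_star] using mk_eq (StarRel.of h)
      exact congrArg MulOpposite.op key⟩

variable {r}

theorem starHom_mk (a : FreeStarAlg X) : starHom r (mk r a) = MulOpposite.op (mk r (star a)) := by
  have h := RingQuot.lift_mkRingHom_apply
    (((mk r : FreeStarAlg X →+* StarQuot r).op).comp FreeStarAlg.starHom) (r := StarRel r)
    (by
      intro a b h
      have key : mk r (star a) = mk r (star b) := by
        cases h with
        | of h => exact mk_eq (StarRel.adj h)
        | adj h => simpa only [star_star] using mk_eq (StarRel.of h)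
      exact congrArg MulOpposite.op key) a
  rw [← RingQuot.mkAlgHom_coe ℂ] at h
  exact h

instance : StarRing (StarQuot r) where
  star a := (starHom r a).unop
  star_involutive a := by
    obtain ⟨a, rfl⟩ := mk_surjective a
    simp [starHom_mk]
  star_mul a b := by simp
  star_add a b := by simp

theorem star_mk (a : FreeStarAlg X) : star (mk r a) = mk r (star a) :=
  congrArg MulOpposite.unop (starHom_mk a)

instance : StarModule ℂ (StarQuot r) where
  star_smul c a := by
    obtain ⟨a, rfl⟩ := mk_surjective a
    rw [← map_smul, star_mk, star_mk, star_smul, map_smul]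

variable (r) in
/-- The class of the generator `x`. -/
def gen (x : X) : StarQuot r := mk r (FreeStarAlg.gen x)

end StarQuot

/-! ### `C^*`-seminorms and completions -/

/-- A `C^*`-seminorm on a unital complex `*`-algebra. -/
structure CStarSeminorm (A : Type) [Ring A] [StarRing A] [Algebra ℂ A] extends Seminorm ℂ A where
  mul_le' : ∀ a b : A, toFun (a * b) ≤ toFun a * toFun b
  star_mul_self' : ∀ a : A, toFun (star a * a) = toFun a ^ 2

namespace CStarSeminorm

section Basic

variable {A : Type} [Ring A] [StarRing A] [Algebra ℂ A]

instance : CoeFun (CStarSeminorm A) (fun _ => A → ℝ) := ⟨fun p => p.toSeminorm⟩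

theorem mul_le (p : CStarSeminorm A) (a b : A) : p (a * b) ≤ p a * p b := p.mul_le' a b

theorem star_mul_self (p : CStarSeminorm A) (a : A) : p (star a * a) = p a ^ 2 :=
  p.star_mul_self' a

theorem nonneg (p : CStarSeminorm A) (a : A) : 0 ≤ p a := apply_nonneg p.toSeminorm a

theorem le_star (p : CStarSeminorm A) (a : A) : p a ≤ p (star a) := by
  rcases (p.nonneg a).eq_or_lt with h | h
  · rw [← h]; exact p.nonneg _
  · have h1 := p.star_mul_self a
    have h2 := p.mul_le (star a) a
    nlinarith

theorem map_star (p : CStarSeminorm A) (a : A) : p (star a) = p a :=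
  le_antisymm (by simpa using p.le_star (star a)) (p.le_star a)

/-- The zero seminorm. -/
instance : Inhabited (CStarSeminorm A) :=
  ⟨{ toSeminorm := 0, mul_le' := fun _ _ => (mul_zero (0 : ℝ)).ge,
     star_mul_self' := fun _ => (zero_pow (M₀ := ℝ) two_ne_zero).symm }⟩

variable (A) in
/-- The largest `C^*`-seminorm of a `*`-algebra on whose elements the `C^*`-seminorms are bounded. -/
def universal (h : ∀ a : A, BddAbove (Set.range fun p : CStarSeminorm A => p a)) :
    CStarSeminorm A where
  toFun a := ⨆ p : CStarSeminorm A, p a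
  map_zero' := by simp
  add_le' a b := ciSup_le fun p => (map_add_le_add p.toSeminorm a b).trans
    (add_le_add (le_ciSup (h a) p) (le_ciSup (h b) p))
  neg' a := by simp
  smul' c a := by
    simp only [map_smul_eq_mul]
    exact (Real.mul_iSup_of_nonneg (norm_nonneg c) _).symm
  mul_le' a b := ciSup_le fun p => (p.mul_le a b).trans
    (mul_le_mul (le_ciSup (h a) p) (le_ciSup (h b) p) (p.nonneg b)
      ((p.nonneg a).trans (le_ciSup (h a) p)))
  star_mul_self' a := by
    have h0 : 0 ≤ ⨆ p : CStarSeminorm A, p a := Real.iSup_nonneg fun p => p.nonneg a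
    apply le_antisymm
    · refine ciSup_le fun p => ?_
      rw [p.star_mul_self]
      exact pow_le_pow_left₀ (p.nonneg a) (le_ciSup (h a) p) 2
    · have h1 : 0 ≤ ⨆ p : CStarSeminorm A, p (star a * a) := Real.iSup_nonneg fun p => p.nonneg _
      rw [← Real.le_sqrt h0 h1]
      refine ciSup_le fun p => Real.le_sqrt_of_sq_le ?_
      rw [← p.star_mul_self]
      exact le_ciSup (h (star a * a)) p

/-- The pull-back `a ↦ ‖f a‖` of the norm of a `C^*`-algebra along a `*`-homomorphism. -/
def pullback {B : Type} [CStarAlgebra B] (f : A →⋆ₐ[ℂ] B) : CStarSeminorm A where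
  toFun a := ‖f a‖
  map_zero' := by simp
  add_le' a b := by rw [map_add]; exact norm_add_le _ _
  neg' a := by simp
  smul' c a := by rw [map_smul, norm_smul]
  mul_le' a b := by rw [map_mul]; exact norm_mul_le _ _
  star_mul_self' a := by rw [map_mul, StarHomClass.map_star, CStarRing.norm_star_mul_self, sq]

end Basic

variable {A : Type} [Ring A] [StarRing A] [Algebra ℂ A]

/-- The `*`-algebra `A`, equipped with the `C^*`-seminorm `p`. -/
def Carrier (_p : CStarSeminorm A) : Type := A

variable (p : CStarSeminorm A)

instance : SeminormedRing p.Carrier :=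
  { p.toSeminorm.toAddGroupSeminorm.toSeminormedAddCommGroup, (inferInstance : Ring A) with
    norm_mul_le := p.mul_le }

theorem norm_carrier (a : p.Carrier) : ‖a‖ = p a := rfl

instance : StarRing p.Carrier := inferInstanceAs (StarRing A)

instance : NormedAlgebra ℂ p.Carrier :=
  { (inferInstance : Algebra ℂ A) with
    norm_smul_le := fun c a => (map_smul_eq_mul p.toSeminorm c a).le }

instance [StarModule ℂ A] : StarModule ℂ p.Carrier := inferInstanceAs (StarModule ℂ A)

instance : NormedStarGroup p.Carrier := ⟨fun a => (p.map_star a).le⟩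

/-- The completion of `A` in the `C^*`-seminorm `p` (elements of seminorm `0` become `0`). -/
abbrev Compl : Type := UniformSpace.Completion p.Carrier

open UniformSpace in
instance : Star p.Compl := ⟨Completion.map star⟩

open UniformSpace in
theorem coe_star (a : p.Carrier) : ((star a : p.Carrier) : p.Compl) = star (a : p.Compl) :=
  (Completion.map_coe (starNormedAddGroupHom (E := p.Carrier)).uniformContinuous a).symm

open UniformSpace in
theorem continuous_star_compl : Continuous (star : p.Compl → p.Compl) := Completion.continuous_map

open UniformSpace in
instance : StarRing p.Compl where
  star_involutive a := by
    induction a using Completion.induction_on with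
    | hp => exact isClosed_eq (p.continuous_star_compl.comp p.continuous_star_compl) continuous_id
    | ih a => rw [← coe_star, ← coe_star, star_star]
  star_mul a b := by
    induction a, b using Completion.induction_on₂ with
    | hp =>
      have h := p.continuous_star_compl
      exact isClosed_eq (by fun_prop) (by fun_prop)
    | ih a b => rw [← Completion.coe_mul, ← coe_star, ← coe_star, ← coe_star, star_mul,
        Completion.coe_mul]
  star_add a b := by
    induction a, b using Completion.induction_on₂ with
    | hp =>
      have h := p.continuous_star_compl
      exact isClosed_eq (by fun_prop) (by fun_prop)
    | ih a b => rw [← Completion.coe_add, ← coe_star, ← coe_star, ← coe_star, star_add,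
        Completion.coe_add]

instance : NormedAlgebra ℂ p.Compl :=
  { (inferInstance : Algebra ℂ p.Compl) with norm_smul_le := norm_smul_le }

open UniformSpace in
instance : CStarRing p.Compl where
  norm_mul_self_le a := by
    induction a using Completion.induction_on with
    | hp =>
      have h := p.continuous_star_compl
      exact isClosed_le (by fun_prop) (by fun_prop)
    | ih a =>
      rw [← coe_star, ← Completion.coe_mul, Completion.norm_coe, Completion.norm_coe]
      exact (p.star_mul_self a).ge.trans' (sq (p a)).ge

variable [StarModule ℂ A]

open UniformSpace in
instance : StarModule ℂ p.Compl where
  star_smul c a := by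
    induction a using Completion.induction_on with
    | hp =>
      have h := p.continuous_star_compl
      exact isClosed_eq (h.comp (continuous_const_smul c)) ((continuous_const_smul _).comp h)
    | ih a =>
      have h1 : c • (a : p.Compl) = ((c • a : p.Carrier) : p.Compl) :=
        (Completion.coe_smul c a).symm
      have h2 : star c • ((star a : p.Carrier) : p.Compl) = ((star c • star a : p.Carrier) : p.Compl) :=
        (Completion.coe_smul _ _).symm
      rw [← coe_star, h1, h2, ← coe_star]
      exact congrArg _ (star_smul c a)

instance : CStarAlgebra p.Compl where

/-- The canonical `*`-homomorphism from `A` to its completion. -/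
def toCompl : A →⋆ₐ[ℂ] p.Compl where
  toFun a := UniformSpace.Completion.coe' (α := p.Carrier) a
  map_one' := UniformSpace.Completion.coe_one p.Carrier
  map_mul' a b := UniformSpace.Completion.coe_mul (α := p.Carrier) a b
  map_zero' := UniformSpace.Completion.coe_zero (α := p.Carrier)
  map_add' a b := UniformSpace.Completion.coe_add (α := p.Carrier) a b
  commutes' _ := rfl
  map_star' a := p.coe_star a

end CStarSeminorm

/-! ### The parameters -/

/-- `q = e^{2πiθ}`. -/
def q (θ : ℝ) : ℂ := Complex.exp (2 * Real.pi * Complex.I * θ)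

/-- `z = e^{iπθ} / (2 i cos πθ)`; its modulus is `1 / (2 |cos πθ|)`. -/
def z (θ : ℝ) : ℂ :=
  Complex.exp (Complex.I * Real.pi * θ) / (2 * Complex.I * (Real.cos (Real.pi * θ) : ℝ))

/-- The element `μ 1 + z a + z̄ a^*`. -/
def R {A : Type} [Ring A] [StarRing A] [Algebra ℂ A] (μ θ : ℝ) (a : A) : A :=
  algebraMap ℂ A μ + z θ • a + star (z θ) • star a

/-! ### The noncommutative torus `C_θ` -/

/-- The generators of `C_θ`. -/
inductive TorusGen | U | V

/-- The relations `VU = qUV`, `U^*U = UU^* = 1`, `V^*V = VV^* = 1`. -/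
inductive TorusRel (θ : ℝ) : FreeStarAlg TorusGen → FreeStarAlg TorusGen → Prop
  | comm : TorusRel θ (.gen .V * .gen .U) (q θ • (.gen .U * .gen .V))
  | star_mul_U : TorusRel θ (star (.gen .U) * .gen .U) 1
  | mul_star_U : TorusRel θ (.gen .U * star (.gen .U)) 1
  | star_mul_V : TorusRel θ (star (.gen .V) * .gen .V) 1
  | mul_star_V : TorusRel θ (.gen .V * star (.gen .V)) 1

/-- The `*`-algebra generated by the relations of the noncommutative torus. -/
abbrev TorusAlg (θ : ℝ) : Type := StarQuot (TorusRel θ)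

theorem TorusAlg.gen_unitary (θ : ℝ) (x : TorusGen) :
    star (StarQuot.gen (TorusRel θ) x) * StarQuot.gen (TorusRel θ) x = 1 := by
  rw [StarQuot.gen, StarQuot.star_mk, ← map_mul, ← map_one (StarQuot.mk (TorusRel θ))]
  cases x
  · exact StarQuot.mk_eq (StarRel.of TorusRel.star_mul_U)
  · exact StarQuot.mk_eq (StarRel.of TorusRel.star_mul_V)

theorem TorusAlg.seminorm_gen_le (θ : ℝ) (p : CStarSeminorm (TorusAlg θ)) (x : TorusGen) :
    p (StarQuot.gen (TorusRel θ) x) ≤ 1 := by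
  have h1 := p.star_mul_self 1
  have h2 := p.star_mul_self (StarQuot.gen (TorusRel θ) x)
  rw [TorusAlg.gen_unitary] at h2
  rw [star_one, one_mul] at h1
  have h3 := p.nonneg (StarQuot.gen (TorusRel θ) x)
  have h4 : p (1 : TorusAlg θ) ≤ 1 := by by_contra! h; nlinarith
  by_contra! h
  nlinarith

/-- The `C^*`-seminorms of the noncommutative torus algebra are bounded on each element. -/
theorem TorusAlg.bddAbove (θ : ℝ) (a : TorusAlg θ) :
    BddAbove (Set.range fun p : CStarSeminorm (TorusAlg θ) => p a) := by
  obtain ⟨a, rfl⟩ := StarQuot.mk_surjective a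
  induction a using FreeStarAlg.induction with
  | scalar c =>
    refine ⟨‖c‖, ?_⟩
    rintro _ ⟨p, rfl⟩
    have h1 := p.star_mul_self 1
    rw [star_one, one_mul] at h1
    have h2 : p (1 : TorusAlg θ) ≤ 1 := by by_contra! h; nlinarith
    simp only [Algebra.algebraMap_eq_smul_one, map_smul, map_one]
    rw [map_smul_eq_mul]
    exact mul_le_of_le_one_right (norm_nonneg c) h2
  | letter y =>
    refine ⟨1, ?_⟩
    rintro _ ⟨p, rfl⟩
    cases y with
    | inl x => exact TorusAlg.seminorm_gen_le θ p x
    | inr x =>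
      have h : StarQuot.mk (TorusRel θ) (FreeStarAlg.letter (Sum.inr x)) =
          star (StarQuot.gen (TorusRel θ) x) := by
        rw [StarQuot.gen, StarQuot.star_mk, FreeStarAlg.star_def, FreeStarAlg.gen,
          FreeStarAlg.starHom_letter]
        rfl
      simp only [h, p.map_star]
      exact TorusAlg.seminorm_gen_le θ p x
  | mul a b ha hb =>
    obtain ⟨s, hs⟩ := ha
    obtain ⟨t, ht⟩ := hb
    refine ⟨s * t, ?_⟩
    rintro _ ⟨p, rfl⟩
    have h1 := hs ⟨p, rfl⟩
    have h2 := ht ⟨p, rfl⟩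
    simp only [map_mul]
    exact (p.mul_le _ _).trans (mul_le_mul h1 h2 (p.nonneg _) ((p.nonneg _).trans h1))
  | add a b ha hb =>
    obtain ⟨s, hs⟩ := ha
    obtain ⟨t, ht⟩ := hb
    refine ⟨s + t, ?_⟩
    rintro _ ⟨p, rfl⟩
    simp only [map_add]
    exact (map_add_le_add p.toSeminorm _ _).trans (add_le_add (hs ⟨p, rfl⟩) (ht ⟨p, rfl⟩))

/-- The largest `C^*`-seminorm on the noncommutative torus algebra. -/
def torusSeminorm (θ : ℝ) : CStarSeminorm (TorusAlg θ) :=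
  CStarSeminorm.universal (TorusAlg θ) (TorusAlg.bddAbove θ)

/-- The noncommutative torus `C_θ`: the universal `C^*`-algebra generated by the relations, that is,
the completion of the `*`-algebra they present in its largest `C^*`-seminorm. -/
abbrev CTorus (θ : ℝ) : Type := (torusSeminorm θ).Compl

/-- The generator `U` of `C_θ`. -/
def U (θ : ℝ) : CTorus θ := (torusSeminorm θ).toCompl (StarQuot.gen (TorusRel θ) .U)

/-- The generator `V` of `C_θ`. -/
def V (θ : ℝ) : CTorus θ := (torusSeminorm θ).toCompl (StarQuot.gen (TorusRel θ) .V)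

/-! ### The deformed torus algebra -/

/-- The generators of the deformed torus algebra. -/
inductive DefGen | W | L

/-- The relations of the deformed torus algebra; the generator `L` is `Λ`. -/
inductive DefRel (μ θ : ℝ) : FreeStarAlg DefGen → FreeStarAlg DefGen → Prop
  | W_L : DefRel μ θ (.gen .W * .gen .L) (q θ • (.gen .L * .gen .W))
  | Ws_L : DefRel μ θ (star (.gen .W) * .gen .L) (star (q θ) • (.gen .L * star (.gen .W)))
  | Ws_Ls : DefRel μ θ (star (.gen .W) * star (.gen .L))
      (q θ • (star (.gen .L) * star (.gen .W)))
  | W_Ls : DefRel μ θ (.gen .W * star (.gen .L)) (star (q θ) • (star (.gen .L) * .gen .W))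
  | star_mul_L : DefRel μ θ (star (.gen .L) * .gen .L) 1
  | mul_star_L : DefRel μ θ (.gen .L * star (.gen .L)) 1
  | W_Ws : DefRel μ θ (.gen .W * star (.gen .W))
      (z θ • .gen .L + star (z θ) • star (.gen .L) + algebraMap ℂ _ μ)
  | Ws_W : DefRel μ θ (star (.gen .W) * .gen .W)
      (-(star (z θ)) • .gen .L - z θ • star (.gen .L) + algebraMap ℂ _ μ)

/-- The unital `*`-algebra `A⁰_{μ,θ}`. (The two-sided ideal generated by the relations is already
invariant under the adjoint.) -/
abbrev DefAlg (μ θ : ℝ) : Type := StarQuot (DefRel μ θ)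

/-- The generator `W` of `A⁰_{μ,θ}`. -/
def W (μ θ : ℝ) : DefAlg μ θ := StarQuot.gen (DefRel μ θ) .W

/-- The generator `Λ` of `A⁰_{μ,θ}`. -/
def Lam (μ θ : ℝ) : DefAlg μ θ := StarQuot.gen (DefRel μ θ) .L

/-- `φ` sends the generators as follows: `W ↦ √(μ 1 + z U + z̄ U^*) V` and `Λ ↦ U`. -/
def IsPhi {μ θ : ℝ} (φ₀ : DefAlg μ θ →⋆ₐ[ℂ] CTorus θ) : Prop :=
  φ₀ (W μ θ) = cfc Real.sqrt (R μ θ (U θ)) * V θ ∧ φ₀ (Lam μ θ) = U θ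

/-- The completion `A_{μ,θ}` of `A⁰_{μ,θ}` in the norm `‖a‖ = ‖φ₀ a‖`. -/
abbrev DefCompl {μ θ : ℝ} (φ₀ : DefAlg μ θ →⋆ₐ[ℂ] CTorus θ) : Type :=
  (CStarSeminorm.pullback φ₀).Compl

/-- The canonical `*`-homomorphism from `A⁰_{μ,θ}` to `A_{μ,θ}`. -/
def toDefCompl {μ θ : ℝ} (φ₀ : DefAlg μ θ →⋆ₐ[ℂ] CTorus θ) : DefAlg μ θ →⋆ₐ[ℂ] DefCompl φ₀ :=
  (CStarSeminorm.pullback φ₀).toCompl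

/-- A positive and invertible element of a `C^*`-algebra. -/
def IsPosInv {A : Type} [CStarAlgebra A] (a : A) : Prop :=
  IsSelfAdjoint a ∧ spectrum ℝ a ⊆ Set.Ioi 0

end NCTorus

end

/-!
The element `μ 1 + z u + z̄ u^*` is `μ 1` plus a self-adjoint element of norm at most
`2 |z| = 1 / |cos πθ| < μ`, for every unitary `u` of every `C^*`-algebra (`isPosInv_R`). So it has
an invertible positive square root, which commutes with `u`. If also `v` is unitary and `vu = quv`,
then `w = √(μ 1 + z u + z̄ u^*) v` and `u` satisfy the relations of `A⁰_{μ,θ}`: the relation for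
`w^* w` comes from `v^* u v = q̄ u` and `z q̄ = -z̄` (`star_mul_R_mul`, `DefAlg.exists_lift`).

For injectivity, `A⁰_{μ,θ}` is spanned by the ordered monomials `W^j Λ^k` with `j, k ∈ ℤ`, where a
negative power is a power of the adjoint (`DefAlg.span_monomial`). Let `π` be the representation of
`C_θ` on `ℓ²(ℤ × ℤ)` in which `U` shifts the first coordinate and `V` shifts the second one, with
a phase. The projections onto the rows commute with `U`, hence with the square root, and `V` shifts
them. So the row `j` of `π (φ₀ a) δ_{(0,0)}` only sees the monomials `W^j Λ^k` of `a`. There,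
`π (φ₀ W^j)` is invertible, and what remains is a combination of the orthonormal vectors
`δ_{(k,0)}`, from which the coefficients can be read off (`DefAlg.injective_of_grid`).

The extension of `φ₀` to the completion is isometric by the choice of the norm, so its range is
closed. The range contains `U = φ(Λ)` and `V = φ((μ 1 + z Λ + z̄ Λ^*)^{-1/2} W)`, so it is all of
`C_θ`.
-/

noncomputable section

namespace NCTorus

/-! ### Universal properties -/

namespace FreeStarAlg

variable {X : Type}

theorem star_letter (y : X ⊕ X) : star (letter y) = letter y.swap := by
  rw [star_def, starHom_letter, MulOpposite.unop_op]

theorem star_algebraMap (c : ℂ) :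
    star (algebraMap ℂ (FreeStarAlg X) c) = algebraMap ℂ (FreeStarAlg X) (starRingEnd ℂ c) := by
  rw [star_def, starHom_algebraMap, MulOpposite.unop_op]

variable {B : Type} [Ring B] [StarRing B] [Algebra ℂ B] [StarModule ℂ B]

/-- The `*`-homomorphism from the free `*`-algebra with prescribed values on the generators. -/
def lift (f : X → B) : FreeStarAlg X →⋆ₐ[ℂ] B where
  __ := (FreeAlgebra.lift ℂ (Sum.elim f (fun x => star (f x))) : FreeAlgebra ℂ (X ⊕ X) →ₐ[ℂ] B)
  map_star' a := by
    let g : FreeStarAlg X →ₐ[ℂ] B := FreeAlgebra.lift ℂ (Sum.elim f (fun x => star (f x)))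
    have hg (y) : g (letter y) = Sum.elim f (fun x => star (f x)) y :=
      FreeAlgebra.lift_ι_apply (R := ℂ) _ y
    change g (star a) = star (g a)
    induction a using FreeStarAlg.induction with
    | scalar c =>
      rw [star_algebraMap, AlgHom.commutes, AlgHom.commutes]
      exact algebraMap_star_comm c
    | letter y => rw [star_letter, hg, hg]; cases y <;> simp
    | mul a b ha hb => rw [star_mul, map_mul, map_mul, star_mul, ha, hb]
    | add a b ha hb => rw [star_add, map_add, map_add, star_add, ha, hb]

theorem lift_gen (f : X → B) (x : X) : lift f (gen x) = f x :=
  FreeAlgebra.lift_ι_apply (R := ℂ) _ (Sum.inl x)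

end FreeStarAlg

namespace StarQuot

variable {X : Type} {r : FreeStarAlg X → FreeStarAlg X → Prop}

theorem mk_letter_inr (x : X) :
    mk r (FreeStarAlg.letter (Sum.inr x)) = star (gen r x) := by
  rw [gen, star_mk, FreeStarAlg.gen, FreeStarAlg.star_letter, Sum.swap_inl]

theorem mk_star_gen (x : X) : mk r (star (FreeStarAlg.gen x)) = star (gen r x) :=
  (star_mk _).symm

variable {B : Type} [Ring B] [StarRing B] [Algebra ℂ B]

/-- The universal property of the `*`-algebra with generators `X` and relations `r`. -/
theorem exists_lift [StarModule ℂ B] (f : X → B)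
    (hf : ∀ a b, r a b → FreeStarAlg.lift f a = FreeStarAlg.lift f b) :
    ∃ F : StarQuot r →⋆ₐ[ℂ] B, ∀ x, F (gen r x) = f x := by
  have hf' : ∀ ⦃a b⦄, StarRel r a b →
      (FreeStarAlg.lift f).toAlgHom a = (FreeStarAlg.lift f).toAlgHom b := by
    intro a b h
    cases h with
    | of h => exact hf _ _ h
    | adj h =>
      change FreeStarAlg.lift f _ = FreeStarAlg.lift f _
      rw [map_star, map_star, hf _ _ h]
  let g : StarQuot r →ₐ[ℂ] B := RingQuot.liftAlgHom ℂ ⟨_, hf'⟩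
  have hg (a) : g (mk r a) = FreeStarAlg.lift f a :=
    RingQuot.liftAlgHom_mkAlgHom_apply ℂ _ hf' a
  refine ⟨{ g with map_star' := fun a => ?_ }, fun x => ?_⟩
  · change g (star a) = star (g a)
    obtain ⟨a, rfl⟩ := mk_surjective a
    rw [star_mk, hg, hg, map_star]
  · exact (hg _).trans (FreeStarAlg.lift_gen f x)

theorem starAlgHom_ext {F G : StarQuot r →⋆ₐ[ℂ] B} (h : ∀ x, F (gen r x) = G (gen r x)) :
    F = G := by
  ext a
  obtain ⟨a, rfl⟩ := mk_surjective a
  induction a using FreeStarAlg.induction with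
  | scalar c => rw [AlgHom.commutes, AlgHomClass.commutes F, AlgHomClass.commutes G]
  | letter y =>
    cases y with
    | inl x => exact h x
    | inr x => rw [mk_letter_inr, map_star, map_star, h]
  | mul a b ha hb => rw [map_mul, map_mul, map_mul, ha, hb]
  | add a b ha hb => rw [map_add, map_add, map_add, ha, hb]

end StarQuot

namespace CStarSeminorm

variable {A : Type} [Ring A] [StarRing A] [Algebra ℂ A] (p : CStarSeminorm A)

theorem denseRange_toCompl : DenseRange p.toCompl :=
  UniformSpace.Completion.denseRange_coe (α := p.Carrier)

theorem norm_toCompl (a : A) : ‖p.toCompl a‖ = p a :=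
  UniformSpace.Completion.norm_coe (E := p.Carrier) a

variable {p} {B : Type} [CStarAlgebra B]

open UniformSpace in
/-- A `*`-homomorphism to a `C^*`-algebra that is bounded by `p` extends to the completion in `p`. -/
theorem exists_extension (f : A →⋆ₐ[ℂ] B) (hf : ∀ a, ‖f a‖ ≤ p a) :
    ∃ F : p.Compl →⋆ₐ[ℂ] B, ∀ a, F (p.toCompl a) = f a := by
  let f' : p.Carrier →+* B := (f : A →+* B)
  have hf' : Continuous f' :=
    AddMonoidHomClass.continuous_of_bound f' 1 fun a => by rw [one_mul]; exact hf a
  let g : p.Compl →+* B := Completion.extensionHom f' hf'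
  have hgc : Continuous g := Completion.continuous_extension
  have hg (a : A) : g (p.toCompl a) = f a := Completion.extensionHom_coe f' hf' a
  refine ⟨{ g with
    commutes' := fun c => ?_
    map_star' := fun a => ?_ }, hg⟩
  · change g (algebraMap ℂ _ c) = _
    rw [← AlgHomClass.commutes p.toCompl c, hg, AlgHomClass.commutes f]
  · change g (star a) = star (g a)
    induction a using p.denseRange_toCompl.induction_on with
    | hp => exact isClosed_eq (hgc.comp p.continuous_star_compl) (continuous_star.comp hgc)
    | ih a => rw [← StarHomClass.map_star, hg, hg, StarHomClass.map_star]

end CStarSeminorm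

/-- The universal property of `C_θ`. -/
theorem CTorus.exists_lift {B : Type} [CStarAlgebra B] {θ : ℝ} {u v : B}
    (hu : u ∈ unitary B) (hv : v ∈ unitary B) (h : v * u = q θ • (u * v)) :
    ∃ F : CTorus θ →⋆ₐ[ℂ] B, F (U θ) = u ∧ F (V θ) = v := by
  obtain ⟨f, hf⟩ := StarQuot.exists_lift (r := TorusRel θ)
    (fun x : TorusGen => match x with | .U => u | .V => v) (by
      intro a b hab
      cases hab <;> simp only [map_mul, map_smul, map_star, map_one, FreeStarAlg.lift_gen]
      · exact h
      · exact hu.1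
      · exact hu.2
      · exact hv.1
      · exact hv.2)
  obtain ⟨F, hF⟩ := CStarSeminorm.exists_extension (p := torusSeminorm θ) f fun a =>
    le_ciSup (TorusAlg.bddAbove θ a) (CStarSeminorm.pullback f)
  exact ⟨F, (hF _).trans (hf .U), (hF _).trans (hf .V)⟩

theorem U_mem_unitary_and_V_mem_unitary (θ : ℝ) :
    U θ ∈ unitary (CTorus θ) ∧ V θ ∈ unitary (CTorus θ) := by
  have h (x : TorusGen) : StarQuot.gen (TorusRel θ) x ∈ unitary (TorusAlg θ) := by
    refine ⟨TorusAlg.gen_unitary θ x, ?_⟩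
    rw [StarQuot.gen, StarQuot.star_mk, ← map_mul, ← map_one (StarQuot.mk (TorusRel θ))]
    cases x
    · exact StarQuot.mk_eq (StarRel.of TorusRel.mul_star_U)
    · exact StarQuot.mk_eq (StarRel.of TorusRel.mul_star_V)
  exact ⟨Unitary.map_mem (torusSeminorm θ).toCompl (h .U),
    Unitary.map_mem (torusSeminorm θ).toCompl (h .V)⟩

theorem V_mul_U (θ : ℝ) : V θ * U θ = q θ • (U θ * V θ) := by
  have h := StarQuot.mk_eq (StarRel.of (TorusRel.comm (θ := θ)))
  rw [map_mul, map_smul, map_mul] at h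
  have h' := congrArg (torusSeminorm θ).toCompl h
  rwa [map_mul, map_smul, map_mul] at h'

/-! ### The parameters and the element `μ 1 + z u + z̄ u^*` -/

theorem star_q_mul_q (θ : ℝ) : star (q θ) * q θ = 1 := by
  have h : q θ = Complex.exp ((2 * Real.pi * θ : ℝ) * Complex.I) := by
    rw [q]; congr 1; push_cast; ring
  change starRingEnd ℂ _ * _ = 1
  rw [Complex.conj_mul', h, Complex.norm_exp_ofReal_mul_I, Complex.ofReal_one, one_pow]

theorem q_ne_zero (θ : ℝ) : q θ ≠ 0 := Complex.exp_ne_zero _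

theorem star_q (θ : ℝ) : star (q θ) = (q θ)⁻¹ := eq_inv_of_mul_eq_one_left (star_q_mul_q θ)

theorem star_z_eq (θ : ℝ) : star (z θ) = -(star (q θ) * z θ) := by
  have h1 : starRingEnd ℂ (Complex.exp (Complex.I * Real.pi * θ)) =
      (q θ)⁻¹ * Complex.exp (Complex.I * Real.pi * θ) := by
    rw [← Complex.exp_conj, q, ← Complex.exp_neg, ← Complex.exp_add]
    congr 1
    simp only [map_mul, Complex.conj_I, Complex.conj_ofReal]
    ring
  rw [star_q]
  change starRingEnd ℂ (z θ) = _
  rw [z, map_div₀, h1]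
  simp only [map_mul, Complex.conj_I, Complex.conj_ofReal, map_ofNat]
  rw [mul_neg, neg_mul, div_neg, mul_div_assoc]

theorem z_eq (θ : ℝ) : z θ = -(q θ * star (z θ)) := by
  rw [star_z_eq, mul_neg, neg_neg, ← mul_assoc, mul_comm (q θ), star_q_mul_q, one_mul]

theorem norm_z (θ : ℝ) : ‖z θ‖ = 1 / (2 * |Real.cos (Real.pi * θ)|) := by
  have h : Complex.I * Real.pi * θ = (Real.pi * θ : ℝ) * Complex.I := by push_cast; ring
  rw [z, h, norm_div, Complex.norm_exp_ofReal_mul_I, norm_mul, norm_mul,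
    Complex.norm_I, Complex.norm_real, Real.norm_eq_abs, Complex.norm_ofNat, mul_one]

/-- The hypothesis on the parameters says that the part `z u + z̄ u^*` is a small perturbation of
`μ 1`. -/
theorem two_mul_norm_z_lt {μ θ : ℝ} (hμ : 0 < μ) (hμθ : 1 < |μ * Real.cos (Real.pi * θ)|) :
    2 * ‖z θ‖ < μ := by
  rw [abs_mul, abs_of_pos hμ] at hμθ
  have hc : 0 < |Real.cos (Real.pi * θ)| := by
    by_contra! h
    nlinarith
  rw [norm_z]
  field_simp
  rwa [mul_comm]

section StarAlgebra

variable {B : Type} [Ring B] [StarRing B] [Algebra ℂ B] [StarModule ℂ B]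

theorem isSelfAdjoint_R (μ θ : ℝ) (a : B) : IsSelfAdjoint (R μ θ a) := by
  rw [isSelfAdjoint_iff, R, star_add, star_add, star_smul, star_smul, star_star, star_star,
    ← algebraMap_star_comm, add_right_comm]
  congr 3
  exact Complex.conj_ofReal μ

omit [StarModule ℂ B] in
theorem map_R {C F : Type} [Ring C] [StarRing C] [Algebra ℂ C] [FunLike F B C]
    [AlgHomClass F ℂ B C] [StarHomClass F B C] (f : F) (μ θ : ℝ) (a : B) :
    f (R μ θ a) = R μ θ (f a) := by
  simp only [R, map_add, map_smul, map_star, AlgHomClass.commutes]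

omit [StarModule ℂ B] in
theorem _root_.Commute.R_right {a b : B} (h : Commute b a) (h' : Commute b (star a)) (μ θ : ℝ) :
    Commute b (R μ θ a) :=
  have h0 : Commute b (algebraMap ℂ B μ) := (Algebra.commutes (μ : ℂ) b).symm
  (h0.add_right (h.smul_right _)).add_right (h'.smul_right _)

omit [StarModule ℂ B] in
theorem mul_star_of_skew {u w : B} {c : ℂ} (hu : u ∈ unitary B) (hc : star c * c = 1)
    (h : w * u = c • (u * w)) : w * star u = star c • (star u * w) := by
  have h1 : star u * w = c • (w * star u) := by
    have h2 := congrArg (fun x => star u * x * star u) h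
    simp only [mul_smul_comm, smul_mul_assoc] at h2
    rwa [← mul_assoc, mul_assoc _ u, hu.2, mul_one, ← mul_assoc, hu.1, one_mul] at h2
  rw [h1, smul_smul, hc, one_smul]

theorem star_mul_of_skew {u w : B} {c : ℂ} (hu : u ∈ unitary B) (hc : star c * c = 1)
    (h : w * u = c • (u * w)) : star w * u = star c • (u * star w) := by
  have h1 := congrArg star (mul_star_of_skew hu hc h)
  rw [star_mul, star_smul, star_mul, star_star, star_star] at h1
  rw [h1, smul_smul, hc, one_smul]

theorem star_mul_star_of_skew {u w : B} {c : ℂ} (hc : star c * c = 1)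
    (h : w * u = c • (u * w)) : star w * star u = c • (star u * star w) := by
  have h1 := congrArg star h
  rw [star_mul, star_smul, star_mul] at h1
  rw [h1, smul_smul, mul_comm, hc, one_smul]

/-- Conjugating by `v` replaces `u` by `q̄ u`, and `z q̄ = -z̄`. -/
theorem star_mul_R_mul {u v : B} {μ θ : ℝ} (hu : u ∈ unitary B) (hv : v ∈ unitary B)
    (h : v * u = q θ • (u * v)) :
    star v * R μ θ u * v = -(star (z θ)) • u - z θ • star u + algebraMap ℂ B μ := by
  have h1 := star_mul_of_skew hu (star_q_mul_q θ) h
  have h2 := star_mul_star_of_skew (star_q_mul_q θ) h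
  rw [R, mul_add, mul_add, mul_smul_comm, mul_smul_comm, h1, h2, ← Algebra.commutes]
  simp only [add_mul, smul_mul_assoc, mul_assoc, hv.1, mul_one, smul_smul]
  have h3 : z θ * star (q θ) = -star (z θ) := by rw [star_z_eq, neg_neg, mul_comm]
  have h4 : star (z θ) * q θ = -z θ := by rw [mul_comm, ← neg_neg (q θ * _), ← z_eq]
  rw [h3, h4, neg_smul (z θ)]
  abel

end StarAlgebra

section CStarAlgebra

variable {B : Type} [CStarAlgebra B]

theorem isPosInv_R {μ θ : ℝ} (hμ : 0 < μ) (hμθ : 1 < |μ * Real.cos (Real.pi * θ)|) {u : B}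
    (hu : u ∈ unitary B) : IsPosInv (R μ θ u) := by
  refine ⟨isSelfAdjoint_R μ θ u, fun x hx => ?_⟩
  have : Nontrivial B := by
    by_contra hB
    rw [not_nontrivial_iff_subsingleton] at hB
    rw [spectrum.of_subsingleton] at hx
    exact hx
  have hR : R μ θ u = algebraMap ℝ B μ + (z θ • u + star (z θ) • star u) := by
    rw [R, add_assoc, IsScalarTower.algebraMap_apply ℝ ℂ B]
    rfl
  have hle : ‖z θ • u + star (z θ) • star u‖ ≤ 2 * ‖z θ‖ := by
    refine (norm_add_le _ _).trans_eq ?_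
    rw [norm_smul, norm_smul, norm_star, norm_star, CStarRing.norm_of_mem_unitary hu]
    ring
  have hx' : x - μ ∈ spectrum ℝ (z θ • u + star (z θ) • star u) := by
    rw [hR] at hx
    rwa [← spectrum.add_mem_add_iff (r := x - μ) (s := μ), sub_add_cancel]
  have h1 := (spectrum.norm_le_norm_of_mem hx').trans hle
  have h2 := two_mul_norm_z_lt hμ hμθ
  rw [Real.norm_eq_abs] at h1
  have h3 := neg_abs_le (x - μ)
  change 0 < x
  linarith

theorem IsPosInv.sqrt_mul_sqrt {a : B} (ha : IsPosInv a) :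
    cfc Real.sqrt a * cfc Real.sqrt a = a := by
  have : IsSelfAdjoint a := ha.1
  rw [← cfc_mul Real.sqrt Real.sqrt a]
  exact (cfc_congr fun x hx => Real.mul_self_sqrt (ha.2 hx).le).trans (cfc_id' ℝ a)

theorem IsPosInv.continuousOn_rpow {a : B} (ha : IsPosInv a) (y : ℝ) :
    ContinuousOn (fun x : ℝ => x ^ y) (spectrum ℝ a) := fun x hx =>
  (Real.continuousAt_rpow_const x y (Or.inl (ha.2 hx).ne')).continuousWithinAt

theorem IsPosInv.rpow_mul_sqrt {a : B} (ha : IsPosInv a) :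
    cfc (fun x : ℝ => x ^ (-(1 / 2) : ℝ)) a * cfc Real.sqrt a = 1 := by
  have : IsSelfAdjoint a := ha.1
  rw [← cfc_mul _ Real.sqrt a (ha.continuousOn_rpow _)]
  refine (cfc_congr fun x hx => ?_).trans (cfc_one ℝ a)
  have hx : 0 < x := ha.2 hx
  rw [Real.sqrt_eq_rpow, ← Real.rpow_add hx, neg_add_cancel, Real.rpow_zero, Pi.one_apply]

theorem IsPosInv.isUnit_sqrt {a : B} (ha : IsPosInv a) : IsUnit (cfc Real.sqrt a) :=
  ⟨⟨_, _, (cfc_commute_cfc _ _ a).eq.trans ha.rpow_mul_sqrt, ha.rpow_mul_sqrt⟩, rfl⟩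

theorem star_sqrt (a : B) : star (cfc Real.sqrt a) = cfc Real.sqrt a :=
  (cfc_predicate Real.sqrt a : IsSelfAdjoint _)

/-- The pair `√(μ 1 + z u + z̄ u^*) v`, `u` satisfies the relations of `A⁰_{μ,θ}`. -/
theorem DefAlg.exists_lift {μ θ : ℝ} (hμ : 0 < μ) (hμθ : 1 < |μ * Real.cos (Real.pi * θ)|)
    {u v : B} (hu : u ∈ unitary B) (hv : v ∈ unitary B) (h : v * u = q θ • (u * v)) :
    ∃ F : DefAlg μ θ →⋆ₐ[ℂ] B, F (W μ θ) = cfc Real.sqrt (R μ θ u) * v ∧ F (Lam μ θ) = u := by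
  have hR := isPosInv_R hμ hμθ hu
  have hsu : Commute (cfc Real.sqrt (R μ θ u)) u :=
    Commute.cfc_real ((Commute.refl u).R_right (hu.2.trans hu.1.symm) μ θ).symm _
  have hskew : cfc Real.sqrt (R μ θ u) * v * u = q θ • (u * (cfc Real.sqrt (R μ θ u) * v)) := by
    rw [mul_assoc, h, mul_smul_comm, ← mul_assoc, hsu.eq, mul_assoc]
  obtain ⟨F, hF⟩ := StarQuot.exists_lift (r := DefRel μ θ)
    (fun x : DefGen => match x with | .W => cfc Real.sqrt (R μ θ u) * v | .L => u) (by
      intro a b hab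
      cases hab <;> simp only [map_mul, map_add, map_sub, map_smul, map_star, map_one,
        FreeStarAlg.lift_gen, AlgHomClass.commutes]
      · exact hskew
      · exact star_mul_of_skew hu (star_q_mul_q θ) hskew
      · exact star_mul_star_of_skew (star_q_mul_q θ) hskew
      · exact mul_star_of_skew hu (star_q_mul_q θ) hskew
      · exact hu.1
      · exact hu.2
      · rw [star_mul, star_sqrt, mul_assoc, ← mul_assoc v, hv.2, one_mul, hR.sqrt_mul_sqrt, R,
          add_assoc, add_comm]
      · rw [star_mul, star_sqrt, mul_assoc, ← mul_assoc _ _ v, hR.sqrt_mul_sqrt, ← mul_assoc,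
          star_mul_R_mul hu hv h])
  exact ⟨F, hF .W, hF .L⟩

end CStarAlgebra

/-! ### Operators that are monomial in a Hilbert basis -/

section HilbertBasis

variable {ι H : Type} [NormedAddCommGroup H] [InnerProductSpace ℂ H] (b : HilbertBasis ι ℂ H)

theorem _root_.HilbertBasis.clm_ext {S T : H →L[ℂ] H} (h : ∀ i, S (b i) = T (b i)) : S = T :=
  ContinuousLinearMap.ext_on (s := Set.range b)
    (Submodule.dense_iff_topologicalClosure_eq_top.2 b.dense_span)
    (by rintro _ ⟨i, rfl⟩; exact h i)

variable [CompleteSpace H]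

/-- A permutation of a Hilbert basis with phases extends to a unitary operator. -/
theorem exists_unitary_perm (σ : Equiv.Perm ι) (c : ι → ℂ) (hc : ∀ i, ‖c i‖ = 1) :
    ∃ T ∈ unitary (H →L[ℂ] H), ∀ i, T (b i) = c i • b (σ i) := by
  classical
  have hc0 (i) : c i ≠ 0 := norm_ne_zero_iff.1 (by rw [hc]; exact one_ne_zero)
  have ho : Orthonormal ℂ (fun i => c i • b (σ i)) := by
    refine ⟨fun i => ?_, fun i j hij => ?_⟩
    · rw [norm_smul, hc, b.orthonormal.1, one_mul]
    · change inner ℂ (c i • b (σ i)) (c j • b (σ j)) = 0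
      rw [inner_smul_left, inner_smul_right, b.orthonormal.2 (σ.injective.ne hij), mul_zero,
        mul_zero]
  let b' : HilbertBasis ι ℂ H := HilbertBasis.mk ho <| by
    rw [← b.dense_span]
    refine Submodule.topologicalClosure_mono (Submodule.span_le.2 ?_)
    rintro _ ⟨i, rfl⟩
    have h := Submodule.smul_mem (Submodule.span ℂ (Set.range fun i => c i • b (σ i)))
      (c (σ.symm i))⁻¹ (Submodule.subset_span ⟨σ.symm i, rfl⟩)
    simpa only [smul_smul, inv_mul_cancel₀ (hc0 _), one_smul, Equiv.apply_symm_apply,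
      SetLike.mem_coe] using h
  have hb' (i) : b' i = c i • b (σ i) := congrFun (HilbertBasis.coe_mk ho _) i
  let T : H ≃ₗᵢ[ℂ] H := b.repr.trans b'.repr.symm
  refine ⟨_, (Unitary.linearIsometryEquiv.symm T).2, fun i => ?_⟩
  rw [Unitary.coe_symm_linearIsometryEquiv_apply]
  change b'.repr.symm (b.repr (b i)) = _
  rw [b.repr_self, b'.repr_symm_single, hb']

/-- The orthogonal projection onto the closed span of a part of a Hilbert basis. -/
theorem exists_projection (s : Set ι) :
    ∃ P : H →L[ℂ] H, IsSelfAdjoint P ∧ (∀ i ∈ s, P (b i) = b i) ∧ ∀ i ∉ s, P (b i) = 0 := by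
  let K : Submodule ℂ H := (Submodule.span ℂ (b '' s)).topologicalClosure
  have : CompleteSpace K := (Submodule.isClosed_topologicalClosure _).completeSpace_coe
  refine ⟨K.starProjection, isSelfAdjoint_starProjection K, fun i hi => ?_, fun i hi => ?_⟩
  · exact Submodule.starProjection_eq_self_iff.2
      (Submodule.le_topologicalClosure _ (Submodule.subset_span ⟨i, hi, rfl⟩))
  · rw [Submodule.starProjection_apply_eq_zero_iff, Submodule.orthogonal_closure,
      Submodule.mem_orthogonal]
    intro x hx
    induction hx using Submodule.span_induction with
    | mem x hx =>
      obtain ⟨j, hj, rfl⟩ := hx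
      exact b.orthonormal.2 fun h => hi (h ▸ hj)
    | zero => exact inner_zero_left _
    | add x y _ _ hx hy => rw [inner_add_left, hx, hy, add_zero]
    | smul c x _ hx => rw [inner_smul_left, hx, mul_zero]

end HilbertBasis

/-! ### Integer powers -/

/-- The power `a ^ n` for `n ≥ 0`, and `(a^*) ^ (-n)` for `n < 0`. -/
def starPow {B : Type} [Ring B] [StarRing B] (a : B) : ℤ → B
  | .ofNat n => a ^ n
  | .negSucc n => star a ^ (n + 1)

section StarPow

variable {B : Type} [Ring B] [StarRing B] (a : B)

theorem starPow_zero : starPow a 0 = 1 := pow_zero a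

theorem starPow_neg_natCast (n : ℕ) : starPow a (-n) = star a ^ n := by
  cases n with
  | zero => exact (pow_zero _).trans (pow_zero _).symm
  | succ n => rfl

theorem map_starPow {C F : Type} [Ring C] [StarRing C] [FunLike F B C] [MonoidHomClass F B C]
    [StarHomClass F B C] (f : F) (n : ℤ) : f (starPow a n) = starPow (f a) n := by
  cases n with
  | ofNat n => exact map_pow f a n
  | negSucc n => exact (map_pow f _ _).trans (by rw [map_star]; rfl)

theorem mul_starPow_natCast (n : ℕ) : a * starPow a n = starPow a (n + 1) :=
  (pow_succ' a n).symm

theorem star_mul_starPow_neg_natCast (n : ℕ) : star a * starPow a (-n) = starPow a (-n - 1) := by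
  rw [show (-n - 1 : ℤ) = -(n + 1 : ℕ) by push_cast; ring, starPow_neg_natCast,
    starPow_neg_natCast, pow_succ']

/-- A product `a * a ^ n` either is a power again or contains the factor `a * star a`. -/
theorem mul_starPow (n : ℤ) : a * starPow a n = starPow a (n + 1) ∨
    a * starPow a n = a * star a * starPow a (n + 1) := by
  cases n with
  | ofNat n => exact Or.inl (mul_starPow_natCast a n)
  | negSucc n =>
    refine Or.inr ?_
    rw [Int.negSucc_eq, neg_add', sub_add_cancel, mul_assoc, star_mul_starPow_neg_natCast]

/-- A product `star a * a ^ n` either is a power again or contains the factor `star a * a`. -/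
theorem star_mul_starPow (n : ℤ) : star a * starPow a n = starPow a (n - 1) ∨
    star a * starPow a n = star a * a * starPow a (n - 1) := by
  cases n with
  | ofNat n =>
    cases n with
    | zero => exact Or.inl (star_mul_starPow_neg_natCast a 0)
    | succ n =>
      refine Or.inr ?_
      rw [Int.ofNat_eq_natCast, Nat.cast_succ, add_sub_cancel_right, mul_assoc,
        mul_starPow_natCast]
  | negSucc n =>
    rw [Int.negSucc_eq, ← Nat.cast_succ]
    exact Or.inl (star_mul_starPow_neg_natCast a _)

variable {a}

theorem mul_starPow_of_unitary (ha : a ∈ unitary B) (n : ℤ) :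
    a * starPow a n = starPow a (n + 1) := by
  rcases mul_starPow a n with h | h
  · exact h
  · rw [h, ha.2, one_mul]

theorem star_mul_starPow_of_unitary (ha : a ∈ unitary B) (n : ℤ) :
    star a * starPow a n = starPow a (n - 1) := by
  rcases star_mul_starPow a n with h | h
  · exact h
  · rw [h, ha.1, one_mul]

theorem isUnit_starPow (ha : IsUnit a) (n : ℤ) : IsUnit (starPow a n) := by
  cases n with
  | ofNat n => exact ha.pow n
  | negSucc n => exact ha.star.pow _

omit [StarRing B] in
/-- An element that commutes with `x` up to a scalar has powers that do, too. -/
theorem skew_pow [Algebra ℂ B] {x y : B} (h : ∃ c : ℂ, x * y = c • (y * x)) (n : ℕ) :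
    ∃ c : ℂ, x * y ^ n = c • (y ^ n * x) := by
  obtain ⟨c, h⟩ := h
  refine ⟨c ^ n, ?_⟩
  induction n with
  | zero => rw [pow_zero, pow_zero, mul_one, one_mul, one_smul]
  | succ n ih =>
    rw [pow_succ y, ← mul_assoc, ih, smul_mul_assoc, mul_assoc, h, mul_smul_comm, smul_smul,
      ← mul_assoc, ← pow_succ]

theorem skew_starPow [Algebra ℂ B] {x : B} (h : ∃ c : ℂ, x * a = c • (a * x))
    (h' : ∃ c : ℂ, x * star a = c • (star a * x)) (n : ℤ) :
    ∃ c : ℂ, x * starPow a n = c • (starPow a n * x) := by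
  cases n with
  | ofNat n => exact skew_pow h n
  | negSucc n => exact skew_pow h' _

end StarPow

/-! ### A spanning family of `A⁰_{μ,θ}` -/

namespace DefAlg

variable (μ θ : ℝ)

theorem Lam_mem_unitary : Lam μ θ ∈ unitary (DefAlg μ θ) := by
  have h1 := StarQuot.mk_eq (StarRel.of (DefRel.star_mul_L (μ := μ) (θ := θ)))
  have h2 := StarQuot.mk_eq (StarRel.of (DefRel.mul_star_L (μ := μ) (θ := θ)))
  rw [map_mul, StarQuot.mk_star_gen, map_one] at h1 h2
  exact ⟨h1, h2⟩

theorem W_mul_Lam : W μ θ * Lam μ θ = q θ • (Lam μ θ * W μ θ) := by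
  have h := StarQuot.mk_eq (StarRel.of (DefRel.W_L (μ := μ) (θ := θ)))
  rwa [map_mul, map_smul, map_mul] at h

theorem W_mul_star_W : W μ θ * star (W μ θ) =
    z θ • Lam μ θ + star (z θ) • star (Lam μ θ) + algebraMap ℂ _ μ := by
  have h := StarQuot.mk_eq (StarRel.of (DefRel.W_Ws (μ := μ) (θ := θ)))
  rwa [map_mul, map_add, map_add, map_smul, map_smul, AlgHom.commutes, StarQuot.mk_star_gen,
    StarQuot.mk_star_gen] at h

theorem star_W_mul_W : star (W μ θ) * W μ θ =
    -(star (z θ)) • Lam μ θ - z θ • star (Lam μ θ) + algebraMap ℂ _ μ := by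
  have h := StarQuot.mk_eq (StarRel.of (DefRel.Ws_W (μ := μ) (θ := θ)))
  rwa [map_mul, map_add, map_sub, map_smul, map_smul, AlgHom.commutes, StarQuot.mk_star_gen,
    StarQuot.mk_star_gen] at h

theorem Lam_mul_starPow_W (n : ℤ) :
    ∃ c : ℂ, Lam μ θ * starPow (W μ θ) n = c • (starPow (W μ θ) n * Lam μ θ) := by
  have hq := star_q_mul_q θ
  refine skew_starPow ⟨star (q θ), ?_⟩ ⟨q θ, ?_⟩ n
  · rw [W_mul_Lam, smul_smul, hq, one_smul]
  · rw [star_mul_of_skew (Lam_mem_unitary μ θ) hq (W_mul_Lam μ θ), smul_smul, mul_comm, hq,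
      one_smul]

theorem star_Lam_mul_starPow_W (n : ℤ) :
    ∃ c : ℂ, star (Lam μ θ) * starPow (W μ θ) n = c • (starPow (W μ θ) n * star (Lam μ θ)) := by
  have hq := star_q_mul_q θ
  refine skew_starPow ⟨q θ, ?_⟩ ⟨star (q θ), ?_⟩ n
  · rw [mul_star_of_skew (Lam_mem_unitary μ θ) hq (W_mul_Lam μ θ), smul_smul, mul_comm, hq,
      one_smul]
  · rw [star_mul_star_of_skew hq (W_mul_Lam μ θ), smul_smul, hq, one_smul]

/-- The ordered monomial `W^j Λ^k` with index `(j, k)`, where a negative power is a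
power of the adjoint. -/
def monomial (i : ℤ × ℤ) : DefAlg μ θ := starPow (W μ θ) i.1 * starPow (Lam μ θ) i.2

/-- The span of the ordered monomials is stable under left multiplication by each generator and
its adjoint, and so is a left ideal that contains `1`. -/
theorem span_monomial : Submodule.span ℂ (Set.range (monomial μ θ)) = ⊤ := by
  set S := Submodule.span ℂ (Set.range (monomial μ θ))
  have mem (j k) : starPow (W μ θ) j * starPow (Lam μ θ) k ∈ S :=
    Submodule.subset_span ⟨(j, k), rfl⟩
  have of_monomial (a : DefAlg μ θ)
      (h : ∀ j k, a * (starPow (W μ θ) j * starPow (Lam μ θ) k) ∈ S) : ∀ s ∈ S, a * s ∈ S := by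
    change S ≤ S.comap (LinearMap.mulLeft ℂ a)
    refine Submodule.span_le.2 ?_
    rintro _ ⟨⟨j, k⟩, rfl⟩
    exact h j k
  have hL : ∀ s ∈ S, Lam μ θ * s ∈ S := of_monomial _ fun j k => by
    obtain ⟨c, hc⟩ := Lam_mul_starPow_W μ θ j
    rw [← mul_assoc, hc, smul_mul_assoc, mul_assoc, mul_starPow_of_unitary (Lam_mem_unitary μ θ)]
    exact S.smul_mem _ (mem _ _)
  have hL' : ∀ s ∈ S, star (Lam μ θ) * s ∈ S := of_monomial _ fun j k => by
    obtain ⟨c, hc⟩ := star_Lam_mul_starPow_W μ θ j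
    rw [← mul_assoc, hc, smul_mul_assoc, mul_assoc,
      star_mul_starPow_of_unitary (Lam_mem_unitary μ θ)]
    exact S.smul_mem _ (mem _ _)
  have hc (c : ℂ) : ∀ s ∈ S, algebraMap ℂ (DefAlg μ θ) c * s ∈ S := fun s hs => by
    rw [← Algebra.smul_def]
    exact S.smul_mem _ hs
  have hW : ∀ s ∈ S, W μ θ * s ∈ S := of_monomial _ fun j k => by
    rw [← mul_assoc]
    rcases mul_starPow (W μ θ) j with h | h
    · rw [h]
      exact mem _ _
    · rw [h, W_mul_star_W, mul_assoc, add_mul, add_mul, smul_mul_assoc, smul_mul_assoc]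
      exact S.add_mem (S.add_mem (S.smul_mem _ (hL _ (mem _ _))) (S.smul_mem _ (hL' _ (mem _ _))))
        (hc _ _ (mem _ _))
  have hW' : ∀ s ∈ S, star (W μ θ) * s ∈ S := of_monomial _ fun j k => by
    rw [← mul_assoc]
    rcases star_mul_starPow (W μ θ) j with h | h
    · rw [h]
      exact mem _ _
    · rw [h, star_W_mul_W, mul_assoc, add_mul, sub_mul, smul_mul_assoc, smul_mul_assoc]
      exact S.add_mem (S.sub_mem (S.smul_mem _ (hL _ (mem _ _))) (S.smul_mem _ (hL' _ (mem _ _))))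
        (hc _ _ (mem _ _))
  have key (a : FreeStarAlg DefGen) : ∀ s ∈ S, StarQuot.mk (DefRel μ θ) a * s ∈ S := by
    induction a using FreeStarAlg.induction with
    | scalar c => rw [AlgHom.commutes]; exact hc c
    | letter y =>
      rcases y with x | x
      · cases x
        · exact hW
        · exact hL
      · rw [StarQuot.mk_letter_inr]
        cases x
        · exact hW'
        · exact hL'
    | mul a b ha hb =>
      intro s hs
      rw [map_mul, mul_assoc]
      exact ha _ (hb _ hs)
    | add a b ha hb =>
      intro s hs
      rw [map_add, add_mul]
      exact S.add_mem (ha _ hs) (hb _ hs)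
  have h1 : (1 : DefAlg μ θ) ∈ S := by
    have h := mem 0 0
    rwa [starPow_zero, starPow_zero, mul_one] at h
  refine eq_top_iff.2 fun a _ => ?_
  obtain ⟨a, rfl⟩ := StarQuot.mk_surjective a
  rw [← mul_one (StarQuot.mk _ a)]
  exact key a 1 h1

end DefAlg

/-! ### Representations of `C_θ` -/

theorem continuous_starAlgHom {A B : Type} [CStarAlgebra A] [CStarAlgebra B] (f : A →⋆ₐ[ℂ] B) :
    Continuous f :=
  AddMonoidHomClass.continuous_of_bound f 1 fun a => by
    rw [one_mul]; exact NonUnitalStarAlgHom.norm_apply_le f a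

/-- A representation `u, v` of the torus relations extends to a `*`-homomorphism `π` of `C_θ`, and
`π ∘ φ₀` sends `W` to `s v`, where `s` is the square root of the positive invertible element
`μ 1 + z u + z̄ u^*`. -/
theorem exists_extension_of_isPhi {B : Type} [CStarAlgebra B] {μ θ : ℝ} (hμ : 0 < μ)
    (hμθ : 1 < |μ * Real.cos (Real.pi * θ)|) {φ₀ : DefAlg μ θ →⋆ₐ[ℂ] CTorus θ} (hφ₀ : IsPhi φ₀)
    {u v : B} (hu : u ∈ unitary B) (hv : v ∈ unitary B) (h : v * u = q θ • (u * v)) :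
    ∃ (π : CTorus θ →⋆ₐ[ℂ] B) (s : B), IsUnit s ∧
      (∀ T, Commute T u → Commute T (star u) → Commute T s) ∧
      π.comp φ₀ (W μ θ) = s * v ∧ π.comp φ₀ (Lam μ θ) = u := by
  obtain ⟨π, hπU, hπV⟩ := CTorus.exists_lift hu hv h
  have hR := isPosInv_R hμ hμθ (U_mem_unitary_and_V_mem_unitary θ).1
  have hπR : π (cfc Real.sqrt (R μ θ (U θ))) = cfc Real.sqrt (R μ θ u) := by
    rw [StarAlgHomClass.map_cfc π Real.sqrt _ (hφ := continuous_starAlgHom π) (ha := hR.1)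
      (hφa := hR.1.map π), map_R, hπU]
  exact ⟨π, _, (isPosInv_R hμ hμθ hu).isUnit_sqrt,
    fun T h1 h2 => (Commute.cfc_real (h1.R_right h2 μ θ).symm _).symm,
    by rw [StarAlgHom.comp_apply, hφ₀.1, map_mul, hπR, hπV],
    by rw [StarAlgHom.comp_apply, hφ₀.2, hπU]⟩

/-! ### A faithful representation on `ℓ²(ℤ × ℤ)` -/

/-- The Hilbert space `ℓ²(ℤ × ℤ)`. -/
abbrev Grid : Type := lp (fun _ : ℤ × ℤ => ℂ) 2

/-- The standard Hilbert basis of `ℓ²(ℤ × ℤ)`. -/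
def gridBasis : HilbertBasis (ℤ × ℤ) ℂ Grid := ⟨LinearIsometryEquiv.refl ℂ Grid⟩

/-- On the grid, `u` is the shift of the first coordinate and `v` is the shift of the second
coordinate, twisted by the phase `q ^ i`. -/
theorem exists_grid_unitaries (θ : ℝ) : ∃ u ∈ unitary (Grid →L[ℂ] Grid),
    ∃ v ∈ unitary (Grid →L[ℂ] Grid), v * u = q θ • (u * v) ∧
      (∀ i j, u (gridBasis (i, j)) = gridBasis (i + 1, j)) ∧
      ∀ i j, ∃ c : ℂ, v (gridBasis (i, j)) = c • gridBasis (i, j + 1) := by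
  have hq : ‖q θ‖ = 1 := by
    have h := congrArg norm (star_q_mul_q θ)
    rw [norm_mul, norm_star, norm_one, ← sq] at h
    exact (pow_eq_one_iff_of_nonneg (norm_nonneg _) two_ne_zero).1 h
  obtain ⟨u, hu, hub⟩ := exists_unitary_perm gridBasis
    ((Equiv.addRight (1 : ℤ)).prodCongr (Equiv.refl ℤ)) (fun _ => 1) fun _ => norm_one
  obtain ⟨v, hv, hvb⟩ := exists_unitary_perm gridBasis
    ((Equiv.refl ℤ).prodCongr (Equiv.addRight (1 : ℤ))) (fun i => q θ ^ i.1)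
    fun i => by rw [norm_zpow, hq, one_zpow]
  have hub' (i j) : u (gridBasis (i, j)) = gridBasis (i + 1, j) := by
    rw [hub, one_smul]
    rfl
  have hvb' (i j) : v (gridBasis (i, j)) = q θ ^ i • gridBasis (i, j + 1) := hvb _
  refine ⟨u, hu, v, hv, gridBasis.clm_ext fun i => ?_, hub', fun i j => ⟨_, hvb' i j⟩⟩
  obtain ⟨i, j⟩ := i
  rw [smul_apply, mul_apply_eq_comp, mul_apply_eq_comp,
    hub', hvb', hvb', map_smul, hub', smul_smul, zpow_add_one₀ (q_ne_zero θ), mul_comm]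

/-- The projections onto the rows of the grid detect the degree in `W`. -/
theorem exists_row_projections {u v : Grid →L[ℂ] Grid}
    (hu : ∀ i j, u (gridBasis (i, j)) = gridBasis (i + 1, j))
    (hv : ∀ i j, ∃ c : ℂ, v (gridBasis (i, j)) = c • gridBasis (i, j + 1)) :
    ∃ P : ℤ → Grid →L[ℂ] Grid, (∀ n, IsSelfAdjoint (P n)) ∧
      (∀ n i j, P n (gridBasis (i, j)) = if j = n then gridBasis (i, j) else 0) ∧
      (∀ n, Commute (P n) u) ∧ ∀ n, P (n + 1) * v = v * P n := by
  choose P hP hPb hPb0 using fun n : ℤ => exists_projection gridBasis {i : ℤ × ℤ | i.2 = n}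
  have hPb' (n i j) : P n (gridBasis (i, j)) = if j = n then gridBasis (i, j) else 0 := by
    split_ifs with h
    · exact hPb n (i, j) h
    · exact hPb0 n (i, j) h
  refine ⟨P, hP, hPb', fun n => gridBasis.clm_ext fun i => ?_,
    fun n => gridBasis.clm_ext fun i => ?_⟩
  · obtain ⟨i, j⟩ := i
    rw [mul_apply_eq_comp, mul_apply_eq_comp, hu, hPb', hPb', apply_ite u,
      hu, map_zero]
  · obtain ⟨i, j⟩ := i
    obtain ⟨c, hc⟩ := hv i j
    rw [mul_apply_eq_comp, mul_apply_eq_comp, hc, map_smul, hPb', hPb',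
      apply_ite v, hc, map_zero]
    simp only [add_left_inj, smul_ite, smul_zero]

/-- Shifting the index of `P` by one along `w` shifts it by `k` along the `k`-th power. -/
theorem row_mul_starPow {B : Type} [Ring B] [StarRing B] {P : ℤ → B} {w : B}
    (hP : ∀ n, IsSelfAdjoint (P n)) (h : ∀ n, P (n + 1) * w = w * P n) (n k : ℤ) :
    P (n + k) * starPow w k = starPow w k * P n := by
  have h' (n : ℤ) : P (n - 1) * star w = star w * P n := by
    have h1 := congrArg star (h (n - 1))
    rw [star_mul, star_mul, hP, hP, sub_add_cancel] at h1
    exact h1.symm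
  cases k with
  | ofNat k =>
    change P (n + k) * w ^ k = w ^ k * P n
    induction k generalizing n with
    | zero => rw [pow_zero, one_mul, mul_one, Nat.cast_zero, add_zero]
    | succ k ih =>
      rw [pow_succ, mul_assoc, ← h, ← mul_assoc, ← mul_assoc, ← ih, Nat.cast_succ, add_assoc,
        add_comm (1 : ℤ)]
  | negSucc k =>
    rw [Int.negSucc_eq, ← Nat.cast_succ, starPow_neg_natCast]
    generalize k.succ = k
    induction k generalizing n with
    | zero => rw [pow_zero, one_mul, mul_one, Nat.cast_zero, neg_zero, add_zero]
    | succ k ih =>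
      rw [pow_succ, mul_assoc, ← h', ← mul_assoc, ← mul_assoc, ← ih, Nat.cast_succ, neg_add_rev,
        ← add_assoc, ← sub_eq_add_neg n 1]

/-- The images of the ordered monomials, applied to the basis vector at the origin, have a dual
family: `W^j Λ^k` moves the origin to the row `j`, and undoing the invertible operator `W^j` there
leaves the basis vector at `(k, 0)`. -/
theorem DefAlg.injective_of_grid {μ θ : ℝ} {u v s : Grid →L[ℂ] Grid}
    (hu : u ∈ unitary (Grid →L[ℂ] Grid)) (hv : v ∈ unitary (Grid →L[ℂ] Grid))
    (hub : ∀ i j, u (gridBasis (i, j)) = gridBasis (i + 1, j))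
    (hvb : ∀ i j, ∃ c : ℂ, v (gridBasis (i, j)) = c • gridBasis (i, j + 1))
    (hs : IsUnit s) (hsu : ∀ T : Grid →L[ℂ] Grid, Commute T u → Commute T (star u) → Commute T s)
    (F : DefAlg μ θ →⋆ₐ[ℂ] (Grid →L[ℂ] Grid)) (hW : F (W μ θ) = s * v)
    (hL : F (Lam μ θ) = u) : Function.Injective F := by
  classical
  obtain ⟨P, hP, hPb, hPu, hPv⟩ := exists_row_projections hub hvb
  have hPs (n) : Commute (P n) s := hsu _ (hPu n) <| by
    have h := (hPu n).star_star
    rwa [hP n] at h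
  have hPw (n k : ℤ) : P (n + k) * starPow (s * v) k = starPow (s * v) k * P n :=
    row_mul_starPow hP (fun n => by rw [← mul_assoc, (hPs _).eq, mul_assoc, hPv, mul_assoc]) n k
  have hw (k : ℤ) : IsUnit (starPow (s * v) k) :=
    isUnit_starPow (hs.mul ⟨Unitary.toUnits ⟨v, hv⟩, rfl⟩) k
  choose y hy using fun k => (hw k).exists_left_inv
  have hu' (m : ℤ) : starPow u m (gridBasis (0, 0)) = gridBasis (m, 0) := by
    induction m using Int.induction_on with
    | zero => rw [starPow_zero]; rfl
    | succ m ih =>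
      rw [← mul_starPow_of_unitary hu, mul_apply_eq_comp, ih, hub]
    | pred m ih =>
      rw [← star_mul_starPow_of_unitary hu, mul_apply_eq_comp, ih,
        ← sub_add_cancel (-(m : ℤ)) 1, ← hub, ← mul_apply_eq_comp, hu.1,
        sub_add_cancel]
      rfl
  -- `P j` commutes with `s` and shifts along `v`, so it can be moved past `W^j`, where it becomes
  -- the projection onto the row of the origin or onto another row.
  have dual (i j : ℤ × ℤ) : inner ℂ (gridBasis (i.2, 0))
      ((y i.1 * P i.1 * F (monomial μ θ j)) (gridBasis (0, 0))) = if j = i then 1 else 0 := by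
    have h1 : y i.1 * P i.1 * F (monomial μ θ j) =
        y i.1 * starPow (s * v) j.1 * P (i.1 - j.1) * starPow u j.2 := by
      rw [monomial, map_mul, map_starPow, map_starPow, hW, hL, ← mul_assoc, mul_assoc (y i.1) (P _),
        mul_assoc (y i.1) (starPow _ _), ← hPw, sub_add_cancel]
    rw [h1, mul_apply_eq_comp, hu', mul_apply_eq_comp, hPb]
    have ho := orthonormal_iff_ite.1 gridBasis.orthonormal (i.2, 0) (j.2, 0)
    by_cases h2 : j.1 = i.1
    · rw [h2, sub_self, if_pos rfl, hy]
      refine ho.trans ?_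
      simp only [Prod.ext_iff, h2, and_true, true_and, eq_comm]
    · rw [if_neg (by omega), map_zero, inner_zero_right, if_neg fun h => h2 (congrArg Prod.fst h)]
  refine (injective_iff_map_eq_zero F).2 fun a ha => ?_
  obtain ⟨c, rfl⟩ := Finsupp.mem_span_range_iff_exists_finsupp.1
    ((span_monomial μ θ).ge (Submodule.mem_top : a ∈ ⊤))
  have hc : c = 0 := by
    ext i
    have h := congrArg (fun T : Grid →L[ℂ] Grid => inner ℂ (gridBasis (i.2, 0))
      ((y i.1 * P i.1 * T) (gridBasis (0, 0)))) ha
    simp only [Finsupp.sum, map_sum, map_smul, Finset.mul_sum, mul_smul_comm, sum_apply, smul_apply,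
      inner_sum, inner_smul_right, dual, mul_zero, zero_apply, inner_zero_right] at h
    simpa using h
  rw [hc, Finsupp.sum_zero_index]

end NCTorus

end

/-! ### The isomorphism of the completion with `C_θ` -/

open NCTorus in
theorem proposition3 (μ θ : ℝ) (hμ : 0 < μ) (hμθ : 1 < |μ * Real.cos (Real.pi * θ)|) :
    IsPosInv (R μ θ (U θ)) ∧
    (∃! φ₀ : DefAlg μ θ →⋆ₐ[ℂ] CTorus θ, IsPhi φ₀) ∧
    ∀ φ₀ : DefAlg μ θ →⋆ₐ[ℂ] CTorus θ, IsPhi φ₀ →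
      Function.Injective φ₀ ∧
      IsPosInv (R μ θ (toDefCompl φ₀ (Lam μ θ))) ∧
      ∃ φ : DefCompl φ₀ ≃⋆ₐ[ℂ] CTorus θ,
        (∀ a : DefAlg μ θ, φ (toDefCompl φ₀ a) = φ₀ a) ∧
        Isometry φ ∧
        φ.symm (U θ) = toDefCompl φ₀ (Lam μ θ) ∧
        φ.symm (V θ) =
          cfc (fun x : ℝ => x ^ (-(1 / 2) : ℝ)) (R μ θ (toDefCompl φ₀ (Lam μ θ))) *
            toDefCompl φ₀ (W μ θ) := by
  obtain ⟨hU, hV⟩ := U_mem_unitary_and_V_mem_unitary θ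
  have hR := isPosInv_R hμ hμθ hU
  refine ⟨hR, ?_, fun φ₀ hφ₀ => ?_⟩
  · obtain ⟨φ₀, hφ₀⟩ := DefAlg.exists_lift hμ hμθ hU hV (V_mul_U θ)
    refine ⟨φ₀, hφ₀, fun ψ hψ => StarQuot.starAlgHom_ext fun x => ?_⟩
    cases x
    · exact hψ.1.trans hφ₀.1.symm
    · exact hψ.2.trans hφ₀.2.symm
  refine ⟨?_, ?_⟩
  · obtain ⟨u, hu, v, hv, hvu, hub, hvb⟩ := exists_grid_unitaries θ
    obtain ⟨π, s, hs, hsu, hW, hL⟩ := exists_extension_of_isPhi hμ hμθ hφ₀ hu hv hvu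
    exact Function.Injective.of_comp
      (DefAlg.injective_of_grid hu hv hub hvb hs hsu (π.comp φ₀) hW hL)
  obtain ⟨hφW, hφL⟩ := hφ₀
  have hΛ := isPosInv_R hμ hμθ (Unitary.map_mem (toDefCompl φ₀) (DefAlg.Lam_mem_unitary μ θ))
  refine ⟨hΛ, ?_⟩
  obtain ⟨Φ, hΦ⟩ := CStarSeminorm.exists_extension (p := CStarSeminorm.pullback φ₀) φ₀
    fun a => le_rfl
  have hΦc : Continuous Φ := continuous_starAlgHom Φ
  have hiso : Isometry Φ := AddMonoidHomClass.isometry_of_norm Φ fun a => by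
    induction a using (CStarSeminorm.pullback φ₀).denseRange_toCompl.induction_on with
    | hp => exact isClosed_eq hΦc.norm continuous_norm
    | ih a => rw [hΦ, CStarSeminorm.norm_toCompl]; rfl
  have hΦL : Φ (toDefCompl φ₀ (Lam μ θ)) = U θ := (hΦ _).trans hφL
  have hΦV : Φ (cfc (fun x : ℝ => x ^ (-(1 / 2) : ℝ)) (R μ θ (toDefCompl φ₀ (Lam μ θ))) *
      toDefCompl φ₀ (W μ θ)) = V θ := by
    rw [map_mul, StarAlgHomClass.map_cfc Φ _ _ (hΛ.continuousOn_rpow _) hΦc (ha := hΛ.1)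
      (hφa := hΛ.1.map Φ), map_R, hΦL, toDefCompl, hΦ, hφW, ← mul_assoc, hR.rpow_mul_sqrt, one_mul]
  -- The range of the isometry `Φ` is closed, and it contains `U` and `V`.
  have hsurj : Function.Surjective Φ := by
    have hmem (a : TorusAlg θ) : (torusSeminorm θ).toCompl a ∈ Set.range Φ := by
      change _ ∈ Φ.range
      obtain ⟨a, rfl⟩ := StarQuot.mk_surjective a
      have hgen (x : TorusGen) :
          (torusSeminorm θ).toCompl (StarQuot.gen (TorusRel θ) x) ∈ Φ.range := by
        cases x
        · exact ⟨_, hΦL⟩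
        · exact ⟨_, hΦV⟩
      induction a using FreeStarAlg.induction with
      | scalar c =>
        rw [AlgHom.commutes, AlgHomClass.commutes]
        exact algebraMap_mem _ c
      | letter y =>
        cases y with
        | inl x => exact hgen x
        | inr x => rw [StarQuot.mk_letter_inr, map_star]; exact star_mem (hgen x)
      | mul a b ha hb => rw [map_mul, map_mul]; exact mul_mem ha hb
      | add a b ha hb => rw [map_add, map_add]; exact add_mem ha hb
    intro x
    refine hiso.isClosedEmbedding.isClosed_range.closure_subset_iff.2 ?_
      ((torusSeminorm θ).denseRange_toCompl x)
    rintro _ ⟨a, rfl⟩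
    exact hmem a
  let φ : DefCompl φ₀ ≃⋆ₐ[ℂ] CTorus θ := StarAlgEquiv.ofBijective Φ ⟨hiso.injective, hsurj⟩
  exact ⟨φ, hΦ, hiso, (StarAlgEquiv.symm_apply_eq φ).2 hΦL.symm,
    (StarAlgEquiv.symm_apply_eq φ).2 hΦV.symm⟩
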